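/- Logarithms are to base $2$. A spectral point is a function $f$ assigning to every finite simple graph a nonnegative real number such that $f(G\sqcup H)=f(G)+f(H)$, $f(G\boxtimes H)=f(G)f(H)$ (strong product), $f(H)\le f(G)$ whenever there is a graph homomorphism $\overline{H}\to\overline{G}$ between the complements, and $f(\overline{K_d})=d$. For a finite graph $G$ and a probability distribution $P$ on $V(G)$, the (logarithmic) probabilistic refinement of $f$ is $$F(G,P)=\lim_{n\to\infty}\frac1n\log f\big(G^{\boxtimes n}[T_{Q_n}]\big),$$ where $(Q_n)_{n\ge1}$ is any sequence of distributions converging to $P$ such that $Q_n$ is the type (empirical distribution) of some string in $V(G)^n$, and $G^{\boxtimes n}[T_{Q_n}]$ is the subgraph of the strong power $G^{\boxtimes n}$ induced on the set $T_{Q_n}$ of strings of type $Q_n$. (The limit exists and does not depend on the choice of the sequence.) Proposition. Let $G$ be a finite simple graph, let $\mu$ be a stationary probability measure on $V(G)^\infty$, i.e. its marginals satisfy $\mu_{m+1,\ldots,m+n}=\mu_{1\ldots n}$ for all $m,n$, and let $f$ be a spectral point. For every $n$ the value $F(G^{\boxtimes n},\mu_{1\ldots n})$ is well defined by the above limit,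 and the $F$-rate exists and equals the infimum: $$\overline F(G,\mu):=\lim_{n\to\infty}\frac1nF(G^{\boxtimes n},\mu_{1\ldots n})=\inf_{n\ge1}\frac1nF(G^{\boxtimes n},\mu_{1\ldots n}).$$ Moreover, let $H$ denote Shannon entropy and put $b_n=H(\mu_{1\ldots n})-F(G^{\boxtimes n},\mu_{1\ldots n})$. Then $b_n\ge0$ for all $n$, the entropy rate $\overline H(\mu)=\lim_{n\to\infty}\frac1nH(\mu_{1\ldots n})$ exists, and $$\overline F(G,\mu)=\overline H(\mu)-\lim_{n\to\infty}\frac{b_n}{n}=\overline H(\mu)-\inf_{n\ge1}\frac{b_n}{n}=\sup_{n\ge1}\Big[\overline H(\mu)-\frac1n\big(H(\mu_{1\ldots n})-F(G^{\boxtimes n},\mu_{1\ldots n})\big)\Big],$$ where in particular $\lim_{n\to\infty}b_n/n$ exists. -/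

import Mathlib

open Filter Topology MeasureTheory

universe u

noncomputable section

namespace AmbiguousSource

/-- The strong product `G ⊠ H`: distinct pairs are adjacent iff in both coordinates the entries
are adjacent or equal. -/
def strongProd {V W : Type u} (G : SimpleGraph V) (H : SimpleGraph W) : SimpleGraph (V × W) where
  Adj x y := x ≠ y ∧ (x.1 = y.1 ∨ G.Adj x.1 y.1) ∧ (x.2 = y.2 ∨ H.Adj x.2 y.2)
  symm := ⟨fun _ _ h => ⟨h.1.symm, h.2.1.imp Eq.symm (fun h => h.symm),
    h.2.2.imp Eq.symm (fun h => h.symm)⟩⟩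
  loopless := ⟨fun _ h => h.1 rfl⟩

/-- The strong power `G^{⊠ n}` on strings of length `n`: distinct strings are adjacent iff in every
coordinate the letters are adjacent or equal. -/
def strongPow {V : Type u} (G : SimpleGraph V) (n : ℕ) : SimpleGraph (Fin n → V) where
  Adj x y := x ≠ y ∧ ∀ i, x i = y i ∨ G.Adj (x i) (y i)
  symm := ⟨fun _ _ h => ⟨h.1.symm, fun i => (h.2 i).imp Eq.symm (fun h => h.symm)⟩⟩
  loopless := ⟨fun _ h => h.1 rfl⟩

/-- A spectral point: an element of the asymptotic spectrum of (finite) graphs. In `mono`, a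
homomorphism between complements is a map sending distinguishable pairs to distinguishable pairs;
in particular the parameter is invariant under graph isomorphism. In `edgeless`, `⊥` is the
edgeless graph on `V`. -/
structure SpectralPoint where
  /-- The value of the parameter on a finite graph. -/
  val : {V : Type u} → [Finite V] → SimpleGraph V → ℝ
  nonneg : ∀ {V : Type u} [Finite V] (G : SimpleGraph V), 0 ≤ val G
  disjUnion : ∀ {V W : Type u} [Finite V] [Finite W] (G : SimpleGraph V) (H : SimpleGraph W),
    val (G.sum H) = val G + val H
  strong : ∀ {V W : Type u} [Finite V] [Finite W] (G : SimpleGraph V) (H : SimpleGraph W),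
    val (strongProd G H) = val G * val H
  mono : ∀ {V W : Type u} [Finite V] [Finite W] (H : SimpleGraph V) (G : SimpleGraph W),
    Nonempty (Hᶜ →g Gᶜ) → val H ≤ val G
  edgeless : ∀ {V : Type u} [Finite V], val (⊥ : SimpleGraph V) = Nat.card V

/-- The type (empirical distribution) of a string: the relative frequency of each letter. -/
def stringType {V : Type u} {n : ℕ} (x : Fin n → V) : V → ℝ :=
  fun a => (Set.ncard {i | x i = a} : ℝ) / n

/-- `Q` is an `n`-type: the type of some string of length `n`. -/
def IsNType {V : Type u} (n : ℕ) (Q : V → ℝ) : Prop :=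
  ∃ x : Fin n → V, stringType x = Q

/-- The type class of `Q`: the strings of length `n` and type `Q`. -/
def typeClass {V : Type u} (n : ℕ) (Q : V → ℝ) : Set (Fin n → V) :=
  {x | stringType x = Q}

/-- `L` is the value at `(G, P)` of the (logarithmic) probabilistic refinement of `f`: for every
sequence of `n`-types `Q n` converging to `P`, the normalized logarithms (to base 2) of `f`
evaluated at the subgraph of `G^{⊠ n}` induced on the type class of `Q n` converge to `L`. -/
def IsProbRefinement (f : SpectralPoint.{u}) {V : Type u} [Finite V] (G : SimpleGraph V)
    (P : V → ℝ) (L : ℝ) : Prop :=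
  ∀ Q : ℕ → V → ℝ, (∀ n, 0 < n → IsNType n (Q n)) → Tendsto Q atTop (𝓝 P) →
    Tendsto (fun n : ℕ => Real.logb 2 (f.val ((strongPow G n).induce (typeClass n (Q n)))) / n)
      atTop (𝓝 L)

/-- The probabilistic refinement `F(G, P)` of the spectral point `f`. -/
def probRefinement (f : SpectralPoint.{u}) {V : Type u} [Finite V] (G : SimpleGraph V)
    (P : V → ℝ) : ℝ :=
  Classical.epsilon (IsProbRefinement f G P)

/-- The marginal `μ_{m+1, …, m+n}` of a distribution on infinite words, as a probability mass
function on strings of length `n`. (Letters are indexed from `0` here.) -/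
def blockMarginal {V : Type u} [MeasurableSpace V] (μ : Measure (ℕ → V)) (m n : ℕ) :
    (Fin n → V) → ℝ :=
  fun x => μ.real {ω | ∀ i : Fin n, ω (m + i) = x i}

/-- The source `μ` is stationary: `μ_{m+1, …, m+n} = μ_{1, …, n}` for all `m`, `n`. -/
def IsStationary {V : Type u} [MeasurableSpace V] (μ : Measure (ℕ → V)) : Prop :=
  ∀ m n : ℕ, blockMarginal μ m n = blockMarginal μ 0 n

/-- The Shannon entropy (in bits) of a probability mass function on a finite set. -/
def entropy {X : Type u} [Fintype X] (P : X → ℝ) : ℝ :=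
  ∑ x, -(P x * Real.logb 2 (P x))

/-- The entropy `H(μ_{1…n})` of the initial segment of length `n`. -/
def blockEntropy {V : Type u} [Fintype V] [MeasurableSpace V] (μ : Measure (ℕ → V)) (n : ℕ) : ℝ :=
  entropy (blockMarginal μ 0 n)

/-- `F(G^{⊠ n}, μ_{1…n})`. -/
def blockF (f : SpectralPoint.{u}) {V : Type u} [Finite V] [MeasurableSpace V]
    (G : SimpleGraph V) (μ : Measure (ℕ → V)) (n : ℕ) : ℝ :=
  probRefinement f (strongPow G n) (blockMarginal μ 0 n)

/-- The `F`-rate of `(G, μ)`: the limit of `F(G^{⊠ n}, μ_{1…n}) / n`. -/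
def FRate (f : SpectralPoint.{u}) {V : Type u} [Finite V] [MeasurableSpace V]
    (G : SimpleGraph V) (μ : Measure (ℕ → V)) : ℝ :=
  limUnder atTop (fun n : ℕ => blockF f G μ n / n)

/-- The entropy rate of `μ`: the limit of `H(μ_{1…n}) / n`. -/
def entropyRate {V : Type u} [Fintype V] [MeasurableSpace V] (μ : Measure (ℕ → V)) : ℝ :=
  limUnder atTop (fun n : ℕ => blockEntropy μ n / n)

end AmbiguousSource

end

/-! Write F_n for `blockF` and b_n for block entropy minus F_n. Both sequences are nonnegative and
subadditive, so Fekete's lemma makes F_n/n and b_n/n converge to their infima. The entropy rate is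
the sum of the two limits, and the remaining formulas are arithmetic.

Subadditivity comes from two inequalities for a distribution P on pairs with marginals P₁, P₂: F(P)
≤ F(P₁) + F(P₂) ≤ F(P) + I, where I is the mutual information. The joint type class lies in the
product of the marginal type classes, which gives the first (`logVal_le_add_pushforward`). Pairs of
coordinate permutations act transitively on that product, so translates of the joint class cover it
greedily. Their number is the ratio of the sizes up to a logarithmic factor, and this ratio has
exponent I (`add_pushforward_le_logVal`). Stationarity identifies the second marginal of an
(m+n)-block with the n-block law.

The same covering bound (`val_le_of_cover`) shows that adding o(n) letters changes log f by o(n).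
This makes the refinement well defined (`exists_isCountLimit`). -/

noncomputable section

namespace AmbiguousSource

/-! ### Confusability, and covering a graph by translates of a subset -/

section

/-- Two vertices are confusable if they are equal or adjacent. -/
def Conf {V : Type*} (G : SimpleGraph V) (x y : V) : Prop := x = y ∨ G.Adj x y

/-- The strong power on strings indexed by an arbitrary type. -/
def powGraph {V : Type u} (G : SimpleGraph V) (ι : Type) : SimpleGraph (ι → V) where
  Adj x y := x ≠ y ∧ ∀ i, x i = y i ∨ G.Adj (x i) (y i)
  symm := ⟨fun _ _ h => ⟨h.1.symm, fun i => (h.2 i).imp Eq.symm (fun h => h.symm)⟩⟩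
  loopless := ⟨fun _ h => h.1 rfl⟩

lemma conf_powGraph {V : Type u} {G : SimpleGraph V} {ι : Type} {x y : ι → V} :
    Conf (powGraph G ι) x y ↔ ∀ i, Conf G (x i) (y i) := by
  constructor
  · rintro (rfl | h) i
    · exact Or.inl rfl
    · exact h.2 i
  · intro h
    by_cases hxy : x = y
    · exact Or.inl hxy
    · exact Or.inr ⟨hxy, h⟩

lemma conf_strongProd {V W : Type u} {G : SimpleGraph V} {H : SimpleGraph W} {x y : V × W} :
    Conf (strongProd G H) x y ↔ Conf G x.1 y.1 ∧ Conf H x.2 y.2 := by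
  constructor
  · rintro (rfl | h)
    · exact ⟨Or.inl rfl, Or.inl rfl⟩
    · exact h.2
  · intro h
    by_cases hxy : x = y
    · exact Or.inl hxy
    · exact Or.inr ⟨hxy, h⟩

lemma conf_induce {V : Type*} {G : SimpleGraph V} {S : Set V} {x y : S} :
    Conf (G.induce S) x y ↔ Conf G (x : V) y := by
  simp [Conf, Subtype.ext_iff]

namespace SpectralPoint

variable (f : SpectralPoint.{u})

/-- Monotonicity: a map that reflects confusability does not decrease the value. -/
lemma val_le_of_conf {V W : Type u} [Finite V] [Finite W] {H : SimpleGraph V} {G : SimpleGraph W}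
    (φ : V → W) (h : ∀ x y, Conf G (φ x) (φ y) → Conf H x y) : f.val H ≤ f.val G := by
  refine f.mono H G ⟨⟨φ, ?_⟩⟩
  intro x y hxy
  rw [SimpleGraph.compl_adj] at hxy ⊢
  refine ⟨fun e => ?_, fun e => ?_⟩
  · rcases h x y (Or.inl e) with h' | h'
    · exact hxy.1 h'
    · exact hxy.2 h'
  · rcases h x y (Or.inr e) with h' | h'
    · exact hxy.1 h'
    · exact hxy.2 h'

lemma val_le_card {V : Type u} [Finite V] (G : SimpleGraph V) : f.val G ≤ Nat.card V := by
  rw [← f.edgeless]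
  exact f.val_le_of_conf id fun x y h => Or.inl (by simpa [Conf] using h)

lemma one_le_val {V : Type u} [Finite V] [Nonempty V] (G : SimpleGraph V) : 1 ≤ f.val G := by
  have h : f.val (⊥ : SimpleGraph PUnit.{u + 1}) ≤ f.val G :=
    f.val_le_of_conf (fun _ => Classical.arbitrary V) fun x y _ => Or.inl rfl
  rwa [f.edgeless, Nat.card_unique, Nat.cast_one] at h

lemma val_induce_univ {V : Type u} [Finite V] (G : SimpleGraph V) :
    f.val G ≤ f.val (G.induce Set.univ) :=
  f.val_le_of_conf (fun x => ⟨x, trivial⟩) fun _ _ h => conf_induce.1 h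

/-- Send each vertex to its copy in S if possible, otherwise to T. The disjoint union has no edges
across, so this only loses confusability. -/
lemma val_induce_le_add {V : Type u} [Finite V] (G : SimpleGraph V) (S T U : Set V)
    (h : U ⊆ S ∪ T) : f.val (G.induce U) ≤ f.val (G.induce S) + f.val (G.induce T) := by
  classical
  rw [← f.disjUnion]
  refine f.val_le_of_conf (fun x => if hx : (x : V) ∈ S then Sum.inl ⟨x, hx⟩
    else Sum.inr ⟨x, (h x.2).resolve_left hx⟩) fun x y hxy => ?_
  by_cases hx : (x : V) ∈ S <;> by_cases hy : (y : V) ∈ S <;>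
    simp only [hx, hy, dif_pos, dif_neg, not_false_eq_true] at hxy <;>
    simp_all [Conf, Subtype.ext_iff]

open Finset in
/-- Greedy covering: if a finite family of confusability-preserving injections moves each vertex to
each vertex equally often, then translates of `S` cover the graph efficiently. -/
theorem val_le_of_cover {X : Type u} [Fintype X] (G : SimpleGraph X) {Γ : Type} [Fintype Γ]
    (act : Γ → X → X) (hinj : ∀ g, Function.Injective (act g))
    (hconf : ∀ g x y, Conf G x y → Conf G (act g x) (act g y))
    (c : ℕ) (hc0 : 0 < c) (hc : ∀ x y, Nat.card {g // act g x = y} = c)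
    (S : Set X) (hS : S.Nonempty) :
    f.val G ≤ f.val (G.induce S) * (Nat.card X / Nat.card S) * (1 + Real.log (Nat.card X)) := by
  classical
  obtain ⟨x0, hx0⟩ := hS
  have hXS : (0 : ℝ) < Nat.card S := by
    have : Nonempty S := ⟨⟨x0, hx0⟩⟩
    exact_mod_cast Nat.card_pos
  have hcf : ∀ x y, #{g | act g x = y} = c := fun x y => by
    rw [← hc x y, Nat.card_eq_fintype_card, Fintype.card_subtype]
  -- Partition Γ by the image of the single point `x0`: every fibre has size `c`.
  have hΓ : Fintype.card Γ = c * Fintype.card X := by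
    have := Finset.card_eq_sum_card_fiberwise (s := (univ : Finset Γ)) (t := (univ : Finset X))
      (f := fun g => act g x0) (fun _ _ => by simp)
    simp only [hcf] at this
    rw [sum_const, smul_eq_mul, mul_comm] at this
    simpa using this
  set T : Finset X := S.toFinset with hT
  have hTc : Nat.card S = #T := by rw [hT, Nat.card_eq_fintype_card, Set.toFinset_card]
  -- averaging
  have havg : ∀ U : Finset X, ∃ g, #T * #U ≤ #{s ∈ T | act g s ∈ U} * Fintype.card X := by
    intro U
    by_contra! hcon
    -- Double counting: each pair (s, u) in T × U is realised by exactly `c` elements g.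
    have h1 : ∑ g, #{s ∈ T | act g s ∈ U} = c * (#T * #U) := by
      calc ∑ g, #{s ∈ T | act g s ∈ U} = ∑ g, ∑ s ∈ T, ∑ u ∈ U, if act g s = u then 1 else 0 := by
            refine sum_congr rfl fun g _ => ?_
            rw [card_filter]
            refine sum_congr rfl fun s _ => ?_
            simp
        _ = ∑ s ∈ T, ∑ u ∈ U, ∑ g, if act g s = u then 1 else 0 := by
            rw [sum_comm]
            exact sum_congr rfl fun s _ => sum_comm
        _ = ∑ s ∈ T, ∑ u ∈ U, c := by
            refine sum_congr rfl fun s _ => sum_congr rfl fun u _ => ?_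
            rw [← card_filter, hcf]
        _ = c * (#T * #U) := by simp; ring
    have h2 : ∑ g, #{s ∈ T | act g s ∈ U} * Fintype.card X < ∑ g : Γ, #T * #U := by
      refine sum_lt_sum_of_nonempty ?_ fun g _ => hcon g
      rw [← card_pos, card_univ, hΓ]
      exact Nat.mul_pos hc0 (Fintype.card_pos_iff.2 ⟨x0⟩)
    rw [← sum_mul, h1, sum_const, card_univ, hΓ, smul_eq_mul] at h2
    exact absurd h2 (by rw [not_lt]; apply le_of_eq; ring)
  -- Greedy step: some translate of S meets U in m ≥ |S||U|/|X| points. Removing them costs at most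
  -- f(S), and this is paid for by the drop from `harmonic n` to `harmonic (n - m)`.
  have key : ∀ n : ℕ, ∀ U : Finset X, #U = n → f.val (G.induce (U : Set X)) ≤
      f.val (G.induce S) * (Nat.card X / Nat.card S) * (harmonic n : ℝ) := by
    intro n
    induction n using Nat.strong_induction_on with
    | _ n ih =>
      intro U hU
      rcases Nat.eq_zero_or_pos n with rfl | hn
      · have := f.val_le_card (G.induce (U : Set X))
        rw [Finset.card_eq_zero] at hU
        subst hU
        simpa using this
      obtain ⟨g, hg⟩ := havg U
      set m := #{s ∈ T | act g s ∈ U} with hm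
      set D : Finset X := {u ∈ U | ∃ s ∈ T, act g s = u} with hD
      have hDm : #D = m := by
        rw [hm, ← card_image_of_injective {s ∈ T | act g s ∈ U} (hinj g)]
        congr 1
        ext u
        simp only [hD, mem_filter, mem_image]
        constructor
        · rintro ⟨hu, s, hs, rfl⟩; exact ⟨s, ⟨hs, hu⟩, rfl⟩
        · rintro ⟨s, ⟨hs, hu⟩, rfl⟩; exact ⟨hu, s, hs, rfl⟩
      have hXpos : 0 < Fintype.card X := Fintype.card_pos_iff.2 ⟨x0⟩
      have hTpos : 0 < #T := by rw [hTc] at hXS; exact_mod_cast hXS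
      have hmpos : 0 < m := by
        by_contra h0
        have : 0 < #T * #U := Nat.mul_pos hTpos (hU ▸ hn)
        rw [Nat.eq_zero_of_not_pos h0, zero_mul] at hg
        omega
      have hmn : m ≤ n := hDm ▸ hU ▸ card_le_card (filter_subset _ _)
      have hsd : #(U \ D) = n - m := by
        rw [card_sdiff_of_subset (filter_subset _ _), hU, hDm]
      have h1 : f.val (G.induce (U : Set X)) ≤
          f.val (G.induce (D : Set X)) + f.val (G.induce ((U \ D : Finset X) : Set X)) :=
        f.val_induce_le_add G _ _ _ fun x hx => by
          by_cases hxD : x ∈ D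
          · exact Or.inl hxD
          · exact Or.inr (by simpa using ⟨hx, hxD⟩)
      -- D lies in a translate of S. Pulling back along `act g` reflects confusability because `act
      -- g` preserves it.
      have h2 : f.val (G.induce (D : Set X)) ≤ f.val (G.induce S) := by
        have hex : ∀ u : (D : Set X), ∃ s : S, act g s = u := fun u => by
          obtain ⟨s, hs, he⟩ := (mem_filter.1 (mem_coe.1 u.2)).2
          exact ⟨⟨s, by simpa [hT] using hs⟩, he⟩
        choose φ hφ using hex
        refine f.val_le_of_conf φ fun x y h => ?_
        rw [conf_induce] at h ⊢
        rw [← hφ x, ← hφ y]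
        exact hconf g _ _ h
      have h3 := ih (n - m) (by omega) (U \ D) hsd
      -- The last m terms of the harmonic sum are each at least 1/n.
      have h4 : ((m : ℝ) / n) + (harmonic (n - m) : ℝ) ≤ (harmonic n : ℝ) := by
        have : (harmonic n : ℚ) = harmonic (n - m) +
            ∑ i ∈ range m, ((↑(n - m + i + 1) : ℚ))⁻¹ := by
          conv_lhs => rw [← Nat.sub_add_cancel hmn]
          simp only [harmonic, sum_range_add]
        have h5 : (m : ℚ) / n ≤ ∑ i ∈ range m, ((↑(n - m + i + 1) : ℚ))⁻¹ := by
          calc (m : ℚ) / n = ∑ i ∈ range m, (n : ℚ)⁻¹ := by simp [div_eq_mul_inv]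
            _ ≤ _ := by
              refine sum_le_sum fun i hi => ?_
              have hi := mem_range.1 hi
              apply inv_anti₀
              · positivity
              · exact_mod_cast (by omega : n - m + i + 1 ≤ n)
        have h6 : (m : ℚ) / n + harmonic (n - m) ≤ harmonic n := by linarith
        have h9 : ((m / n + harmonic (n - m) : ℚ) : ℝ) ≤ (harmonic n : ℝ) := Rat.cast_le.2 h6
        push_cast at h9 ⊢
        exact h9
      have h7 : (1 : ℝ) ≤ (Nat.card X / Nat.card S) * (m / n) := by
        rw [hTc] at hXS ⊢
        have hn' : (0 : ℝ) < n := by exact_mod_cast hn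
        rw [div_mul_div_comm, one_le_div (by positivity), Nat.card_eq_fintype_card]
        rw [hU] at hg
        rw [mul_comm (Fintype.card X : ℝ)]
        exact_mod_cast hg
      have h8 := f.nonneg (G.induce S)
      calc f.val (G.induce (U : Set X)) ≤ f.val (G.induce S) * 1 +
            f.val (G.induce S) * (Nat.card X / Nat.card S) * (harmonic (n - m) : ℝ) := by
              linarith
        _ ≤ f.val (G.induce S) * ((Nat.card X / Nat.card S) * (m / n)) +
            f.val (G.induce S) * (Nat.card X / Nat.card S) * (harmonic (n - m) : ℝ) := by
              gcongr
        _ = f.val (G.induce S) * (Nat.card X / Nat.card S) *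
            ((m / n) + (harmonic (n - m) : ℝ)) := by ring
        _ ≤ _ := by gcongr
  calc f.val G ≤ f.val (G.induce Set.univ) := f.val_induce_univ G
    _ ≤ f.val (G.induce S) * (Nat.card X / Nat.card S) * (harmonic (Nat.card X) : ℝ) := by
      have := key _ univ rfl
      rw [coe_univ] at this
      rwa [Nat.card_eq_fintype_card] at *
    _ ≤ _ := by
      have := f.nonneg (G.induce S)
      gcongr
      exact harmonic_le_one_add_log _

/-- Cover G by translates of the image of φ. The value on the image is at most f(H), since the
inverse of φ reflects confusability. Only the logarithm of the size ratio and a log-log term are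
lost. -/
lemma logb_val_le_of_cover {X Y : Type u} [Fintype X] [Finite Y] [Nonempty Y] (G : SimpleGraph X)
    (H : SimpleGraph Y) (φ : Y → X) (hφ : Function.Injective φ)
    (hGH : ∀ x y, Conf H x y → Conf G (φ x) (φ y)) {Γ : Type} [Fintype Γ]
    (act : Γ → X → X) (hinj : ∀ g, Function.Injective (act g))
    (hconf : ∀ g x y, Conf G x y → Conf G (act g x) (act g y))
    (c : ℕ) (hc0 : 0 < c) (hc : ∀ x y, Nat.card {g // act g x = y} = c) :
    Real.logb 2 (f.val G) ≤ Real.logb 2 (f.val H) +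
      (Real.logb 2 (Nat.card X) - Real.logb 2 (Nat.card Y)) +
      Real.logb 2 (1 + Real.log (Nat.card X)) := by
  have : Nonempty X := ⟨φ (Classical.arbitrary Y)⟩
  have hX : (1 : ℝ) ≤ Nat.card X := by exact_mod_cast Nat.card_pos
  have hY : (1 : ℝ) ≤ Nat.card Y := by exact_mod_cast Nat.card_pos
  have hG := f.one_le_val G
  have hH := f.one_le_val H
  have hlog := Real.log_nonneg hX
  have h1 := f.val_le_of_cover G act hinj hconf c hc0 hc (Set.range φ) (Set.range_nonempty φ)
  have h2 : f.val (G.induce (Set.range φ)) ≤ f.val H := by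
    refine f.val_le_of_conf (fun x => x.2.choose) fun x y h => ?_
    rw [conf_induce, ← x.2.choose_spec, ← y.2.choose_spec]
    exact hGH _ _ h
  rw [Nat.card_range_of_injective hφ] at h1
  have h3 : f.val G ≤ f.val H * (Nat.card X / Nat.card Y) * (1 + Real.log (Nat.card X)) :=
    h1.trans (by gcongr)
  rw [← Real.logb_div (by positivity) (by positivity),
    ← Real.logb_mul (by positivity) (by positivity), ← Real.logb_mul (by positivity) (by positivity)]
  exact Real.logb_le_logb_of_le one_lt_two (by positivity) h3

end SpectralPoint

end

/-! ### Strings with prescribed letter counts and their permutations -/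

section

/-- The strings indexed by `ι` in which each letter `a` occurs exactly `k a` times. -/
def countClass {V : Type u} (ι : Type) (k : V → ℕ) : Set (ι → V) :=
  {x | ∀ a, Nat.card {i // x i = a} = k a}

variable {V : Type u}

lemma card_eq_of_mem_countClass [Fintype V] {ι : Type} [Fintype ι] {k : V → ℕ} {x : ι → V}
    (hx : x ∈ countClass ι k) : Fintype.card ι = ∑ a, k a := by
  classical
  rw [Fintype.card_congr (Equiv.sigmaFiberEquiv x).symm, Fintype.card_sigma]
  exact Finset.sum_congr rfl fun a _ => by rw [← hx a, Nat.card_eq_fintype_card]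

lemma countClass_nonempty [Fintype V] {ι : Type} [Fintype ι] {k : V → ℕ} (h : Fintype.card ι = ∑ a, k a) :
    (countClass ι k).Nonempty := by
  classical
  have e : ι ≃ Σ a, Fin (k a) := Fintype.equivOfCardEq (by simp [h])
  refine ⟨fun i => (e i).1, fun a => ?_⟩
  rw [Nat.card_congr ((e.subtypeEquiv fun _ => Iff.rfl).trans (Equiv.sigmaSubtype a) :
    {i // (e i).1 = a} ≃ Fin (k a)), Nat.card_fin]

lemma comp_mem_countClass {ι κ : Type} {k : V → ℕ} {x : ι → V}
    (e : κ ≃ ι) (hx : x ∈ countClass ι k) : x ∘ e ∈ countClass κ k := fun a => by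
  rw [← hx a]
  exact Nat.card_congr (e.subtypeEquiv fun _ => Iff.rfl)

/-- These permutations form a coset of the stabiliser of x, which is the product of the symmetric
groups of the level sets of x. -/
lemma card_perm_comp_eq [Fintype V] {ι : Type} [Fintype ι] {k : V → ℕ} {x y : ι → V}
    (hx : x ∈ countClass ι k) (hy : y ∈ countClass ι k) :
    Nat.card {σ : Equiv.Perm ι // x ∘ σ = y} = ∏ a, (k a).factorial := by
  classical
  have hfib : ∀ a, Nonempty ({i // y i = a} ≃ {i // x i = a}) := fun a =>
    ⟨Fintype.equivOfCardEq (by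
      rw [← Nat.card_eq_fintype_card, ← Nat.card_eq_fintype_card, hx a, hy a])⟩
  have e := fun a => Classical.choice (hfib a)
  -- A permutation carrying x to y, glued from bijections between their level sets.
  let τ : Equiv.Perm ι := (Equiv.sigmaFiberEquiv y).symm.trans
    ((Equiv.sigmaCongrRight e).trans (Equiv.sigmaFiberEquiv x))
  have hτ : x ∘ τ = y := funext fun i => (e (y i) ⟨i, rfl⟩).2
  have : Nat.card {σ : Equiv.Perm ι // x ∘ σ = y} = Nat.card {σ : Equiv.Perm ι // x ∘ σ = x} := by
    refine Nat.card_congr ((Equiv.mulRight τ⁻¹).subtypeEquiv fun σ => ?_)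
    rw [Equiv.coe_mulRight, Equiv.Perm.coe_mul, ← Function.comp_assoc]
    constructor
    · intro h
      rw [h, ← hτ]
      ext i; simp
    · intro h
      rw [← hτ]
      nth_rw 2 [← h]
      ext i; simp
  rw [this, Nat.card_eq_fintype_card, DomMulAct.stabilizer_card]
  exact Finset.prod_congr rfl fun a _ => by rw [← hx a, Nat.card_eq_fintype_card]

/-- Sort all permutations by the string they make of a fixed x. -/
lemma card_countClass_mul [Fintype V] {ι : Type} [Fintype ι] {k : V → ℕ} (h : Fintype.card ι = ∑ a, k a) :
    Nat.card (countClass ι k) * ∏ a, (k a).factorial = (∑ a, k a).factorial := by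
  classical
  obtain ⟨x, hx⟩ := countClass_nonempty h
  rw [← h, ← Fintype.card_perm]
  rw [Fintype.card_congr (Equiv.sigmaFiberEquiv
    (fun σ : Equiv.Perm ι => (⟨x ∘ σ, comp_mem_countClass σ hx⟩ : countClass ι k))).symm,
    Fintype.card_sigma]
  rw [Finset.sum_congr rfl fun y _ => show _ = ∏ a, (k a).factorial from ?_]
  · simp [Nat.card_eq_fintype_card]
  · rw [← card_perm_comp_eq hx y.2, ← Nat.card_eq_fintype_card]
    exact Nat.card_congr (Equiv.subtypeEquivRight fun σ => by simp [Subtype.ext_iff])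

/-- Coordinate permutations act on a count class. -/
def permAct {ι : Type} {k : V → ℕ} (σ : Equiv.Perm ι) (x : countClass ι k) : countClass ι k :=
  ⟨x.1 ∘ σ, comp_mem_countClass σ x.2⟩

lemma permAct_injective {ι : Type} {k : V → ℕ} (σ : Equiv.Perm ι) :
    Function.Injective (permAct (k := k) σ) := fun x y h => by
  have h' : x.1 ∘ σ = y.1 ∘ σ := congrArg Subtype.val h
  exact Subtype.ext (σ.surjective.injective_comp_right h')

lemma card_permAct [Fintype V] {ι : Type} [Fintype ι] {k : V → ℕ} (x y : countClass ι k) :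
    Nat.card {σ : Equiv.Perm ι // permAct σ x = y} = ∏ a, (k a).factorial := by
  rw [← card_perm_comp_eq x.2 y.2]
  exact Nat.card_congr (Equiv.subtypeEquivRight fun σ => by simp [permAct, Subtype.ext_iff])

/-- The graph induced by a strong power on a count class. -/
abbrev classGraph (G : SimpleGraph V) (ι : Type) (k : V → ℕ) : SimpleGraph (countClass ι k) :=
  (powGraph G ι).induce (countClass ι k)

lemma conf_classGraph {G : SimpleGraph V} {ι : Type} {k : V → ℕ} {x y : countClass ι k} :
    Conf (classGraph G ι k) x y ↔ ∀ i, Conf G (x.1 i) (y.1 i) := by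
  rw [conf_induce, conf_powGraph]

lemma conf_permAct {G : SimpleGraph V} {ι : Type} {k : V → ℕ} (σ : Equiv.Perm ι)
    (x y : countClass ι k) (h : Conf (classGraph G ι k) x y) :
    Conf (classGraph G ι k) (permAct σ x) (permAct σ y) :=
  conf_classGraph.2 fun i => conf_classGraph.1 h (σ i)

lemma val_classGraph_congr [Fintype V] (f : SpectralPoint.{u}) (G : SimpleGraph V) {ι κ : Type} [Finite ι]
    [Finite κ] (e : ι ≃ κ) (k : V → ℕ) :
    f.val (classGraph G ι k) = f.val (classGraph G κ k) := by
  apply le_antisymm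
  · refine f.val_le_of_conf (fun x => ⟨x.1 ∘ e.symm, comp_mem_countClass e.symm x.2⟩) ?_
    intro x y h
    rw [conf_classGraph] at h ⊢
    intro i
    simpa using h (e i)
  · refine f.val_le_of_conf (fun x => ⟨x.1 ∘ e, comp_mem_countClass e x.2⟩) ?_
    intro x y h
    rw [conf_classGraph] at h ⊢
    intro i
    simpa using h (e.symm i)

lemma card_countClass_congr {ι κ : Type} (e : ι ≃ κ) (k : V → ℕ) :
    Nat.card (countClass ι k) = Nat.card (countClass κ k) := by
  refine Nat.card_congr ((e.arrowCongr (Equiv.refl V)).subtypeEquiv fun x => ?_)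
  constructor
  · exact fun h => comp_mem_countClass e.symm h
  · intro h
    have := comp_mem_countClass e h
    convert this
    ext i; simp

/-- The (base 2) logarithm of a spectral point on the count class. -/
def logVal [Fintype V] (f : SpectralPoint.{u}) (G : SimpleGraph V) (k : V → ℕ) : ℝ :=
  Real.logb 2 (f.val (classGraph G (Fin (∑ a, k a)) k))

/-- The number of strings with given letter counts. -/
def classCard [Fintype V] (k : V → ℕ) : ℕ := Nat.card (countClass (Fin (∑ a, k a)) k)

lemma logVal_eq [Fintype V] (f : SpectralPoint.{u}) (G : SimpleGraph V) {ι : Type} [Fintype ι] {k : V → ℕ}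
    (h : Fintype.card ι = ∑ a, k a) :
    Real.logb 2 (f.val (classGraph G ι k)) = logVal f G k := by
  rw [logVal, val_classGraph_congr f G (Fintype.equivFinOfCardEq h)]

lemma classCard_eq [Fintype V] {ι : Type} [Fintype ι] {k : V → ℕ} (h : Fintype.card ι = ∑ a, k a) :
    Nat.card (countClass ι k) = classCard k := by
  rw [classCard, card_countClass_congr (Fintype.equivFinOfCardEq h)]

lemma classCard_mul [Fintype V] (k : V → ℕ) :
    classCard k * ∏ a, (k a).factorial = (∑ a, k a).factorial :=
  card_countClass_mul (by simp)

lemma classCard_pos [Fintype V] (k : V → ℕ) : 0 < classCard k := by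
  rcases Nat.eq_zero_or_pos (classCard k) with h | h
  · have := classCard_mul k
    rw [h, zero_mul] at this
    exact absurd this.symm (Nat.factorial_ne_zero _)
  · exact h

instance [Fintype V] (k : V → ℕ) : Nonempty (countClass (Fin (∑ a, k a)) k) :=
  (countClass_nonempty (by simp)).to_subtype

lemma logVal_nonneg [Fintype V] (f : SpectralPoint.{u}) (G : SimpleGraph V) (k : V → ℕ) : 0 ≤ logVal f G k :=
  Real.logb_nonneg one_lt_two (f.one_le_val _)

lemma logVal_le [Fintype V] (f : SpectralPoint.{u}) (G : SimpleGraph V) (k : V → ℕ) :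
    logVal f G k ≤ Real.logb 2 (classCard k) :=
  Real.logb_le_logb_of_le one_lt_two (zero_lt_one.trans_le (f.one_le_val _)) (f.val_le_card _)

lemma classCard_le [Fintype V] (k : V → ℕ) : classCard k ≤ Fintype.card V ^ (∑ a, k a) := by
  classical
  refine (Nat.card_le_card_of_injective _ Subtype.val_injective).trans ?_
  simp

end

/-! ### Exponential growth of type classes -/

section

/-- For n ≥ 1, log(1 + ck) ≤ log n + log(1 + c·k/n), and the second term stays bounded. -/
lemma tendsto_log_linear_div {k : ℕ → ℕ} {p : ℝ}
    (hk : Tendsto (fun n : ℕ => (k n : ℝ) / n) atTop (𝓝 p)) {c : ℝ} (hc : 0 ≤ c) :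
    Tendsto (fun n : ℕ => Real.log (1 + c * k n) / n) atTop (𝓝 0) := by
  have hp : 0 ≤ p := ge_of_tendsto' hk fun n => by positivity
  have h1 : Tendsto (fun n : ℕ => Real.log n / (n : ℝ)) atTop (𝓝 0) :=
    Real.isLittleO_log_id_atTop.tendsto_div_nhds_zero.comp tendsto_natCast_atTop_atTop
  have h2 : Tendsto (fun n : ℕ => Real.log (1 + c * (k n / n)) / (n : ℝ)) atTop (𝓝 0) :=
    (((hk.const_mul c).const_add 1).log (by positivity)).div_atTop tendsto_natCast_atTop_atTop
  refine tendsto_of_tendsto_of_tendsto_of_le_of_le' tendsto_const_nhds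
    (by simpa using h1.add h2) (Eventually.of_forall fun n => ?_) ?_
  · exact div_nonneg (Real.log_nonneg (by have : 0 ≤ c * k n := by positivity
                                          linarith)) (by positivity)
  · filter_upwards [eventually_ge_atTop 1] with n hn
    have hn' : (1 : ℝ) ≤ n := by exact_mod_cast hn
    rw [← add_div]
    gcongr
    rw [← Real.log_mul (by positivity) (by positivity)]
    apply Real.log_le_log (by positivity)
    have : (n : ℝ) * (1 + c * (k n / n)) = n + c * k n := by field_simp
    rw [this]
    gcongr

/-- The upper bound uses that the Stirling sequence decreases from its value at 1. The error is
written with `1 * m` to fit `tendsto_log_linear_div`. -/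
lemma log_factorial_bounds (m : ℕ) :
    (m : ℝ) * Real.log m - m ≤ Real.log m.factorial ∧
      Real.log m.factorial ≤ m * Real.log m - m + (1 + Real.log (1 + 1 * m)) := by
  rcases Nat.eq_zero_or_pos m with rfl | hm
  · simp
  have hm' : (1 : ℝ) ≤ m := by exact_mod_cast hm
  have hlog := Real.log_nonneg hm'
  constructor
  · have h := Stirling.le_log_factorial_stirling hm.ne'
    have h2 : 0 ≤ Real.log (2 * Real.pi) := Real.log_nonneg (by linarith [Real.two_le_pi])
    linarith
  · have h : Stirling.stirlingSeq m ≤ Stirling.stirlingSeq 1 := by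
      have := Stirling.stirlingSeq'_antitone (Nat.zero_le (m - 1))
      simpa [Nat.sub_add_cancel hm] using this
    have h1 := Real.log_le_log (by
      have := Stirling.stirlingSeq'_pos (m - 1)
      simpa [Nat.sub_add_cancel hm] using this) h
    rw [Stirling.log_stirlingSeq_formula, Stirling.log_stirlingSeq_formula,
      Real.log_div (by positivity) (Real.exp_pos 1).ne', Real.log_exp,
      Real.log_mul (by norm_num) (by positivity)] at h1
    have h3 : Real.log m ≤ Real.log (1 + 1 * m) := Real.log_le_log (by positivity) (by linarith)
    norm_num at h1
    linarith

/-- The corrections in k log n and k are linear in k, so they cancel in the logarithm of a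
multinomial coefficient. -/
lemma tendsto_log_factorial {k : ℕ → ℕ} {p : ℝ}
    (hk : Tendsto (fun n : ℕ => (k n : ℝ) / n) atTop (𝓝 p)) :
    Tendsto (fun n : ℕ => (Real.log (k n).factorial - k n * Real.log n + k n) / n) atTop
      (𝓝 (p * Real.log p)) := by
  have h1 : Tendsto (fun n : ℕ => (k n : ℝ) / n * Real.log (k n / n)) atTop
      (𝓝 (p * Real.log p)) := Real.continuous_mul_log.continuousAt.tendsto.comp hk
  have h2 := (tendsto_log_linear_div hk zero_le_one).add (tendsto_one_div_atTop_nhds_zero_nat)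
  have h3 := h1.add h2
  simp only [add_zero] at h3
  have key : ∀ n : ℕ, 0 < n → (k n : ℝ) / n * Real.log (k n / n) =
      (k n * Real.log (k n) - k n * Real.log n) / n := fun n hn => by
    have hn' : (0 : ℝ) < n := by exact_mod_cast hn
    rcases Nat.eq_zero_or_pos (k n) with h0 | h0
    · simp [h0]
    · have : (0 : ℝ) < k n := by exact_mod_cast h0
      rw [Real.log_div this.ne' hn'.ne']
      ring
  refine tendsto_of_tendsto_of_tendsto_of_le_of_le' h1 h3 ?_ ?_
  · filter_upwards [eventually_gt_atTop 0] with n hn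
    rw [key n hn]
    refine div_le_div_of_nonneg_right ?_ n.cast_nonneg
    linarith [(log_factorial_bounds (k n)).1]
  · filter_upwards [eventually_gt_atTop 0] with n hn
    rw [key n hn, ← add_div, ← add_div]
    refine div_le_div_of_nonneg_right ?_ n.cast_nonneg
    linarith [(log_factorial_bounds (k n)).2]

variable {V : Type u} [Fintype V]

/-- The exponential growth rate (base 2) of the type classes of letter frequencies close to `P`. -/
def classRate (P : V → ℝ) : ℝ :=
  ((∑ a, P a) * Real.log (∑ a, P a) - ∑ a, P a * Real.log (P a)) / Real.log 2

lemma tendsto_sum_div {k : ℕ → V → ℕ} {P : V → ℝ}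
    (hk : ∀ a, Tendsto (fun n : ℕ => (k n a : ℝ) / n) atTop (𝓝 (P a))) :
    Tendsto (fun n : ℕ => ((∑ a, k n a : ℕ) : ℝ) / n) atTop (𝓝 (∑ a, P a)) := by
  simpa [Finset.sum_div] using tendsto_finsetSum Finset.univ fun a _ => hk a

lemma tendsto_logb_classCard {k : ℕ → V → ℕ} {P : V → ℝ}
    (hk : ∀ a, Tendsto (fun n : ℕ => (k n a : ℝ) / n) atTop (𝓝 (P a))) :
    Tendsto (fun n : ℕ => Real.logb 2 (classCard (k n)) / n) atTop (𝓝 (classRate P)) := by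
  have h := ((tendsto_log_factorial (tendsto_sum_div hk)).sub
    (tendsto_finsetSum Finset.univ fun a _ => tendsto_log_factorial (hk a))).div_const (Real.log 2)
  refine h.congr fun n => ?_
  have h1 : (classCard (k n) : ℝ) * ∏ a, ((k n a).factorial : ℝ) = (∑ a, k n a).factorial := by
    exact_mod_cast classCard_mul (k n)
  have h2 : (classCard (k n) : ℝ) ≠ 0 := by exact_mod_cast (classCard_pos (k n)).ne'
  have h3 : ∀ a, ((k n a).factorial : ℝ) ≠ 0 := fun a => by
    exact_mod_cast Nat.factorial_ne_zero _
  rw [← h1, Real.log_mul h2 (Finset.prod_ne_zero_iff.2 fun a _ => h3 a),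
    Real.log_prod (fun a _ => h3 a), ← Finset.sum_div, Finset.sum_add_distrib,
    Finset.sum_sub_distrib, ← Finset.sum_mul, Real.logb, Nat.cast_sum]
  ring

lemma classRate_eq_entropy {P : V → ℝ} (h : ∑ a, P a = 1) : classRate P = entropy P := by
  simp only [classRate, h, entropy, Real.logb, Real.log_one, mul_zero, zero_sub, neg_div,
    Finset.sum_div, Finset.sum_neg_distrib, mul_div_assoc]

/-- The logarithmic factor in the covering bound is negligible: a class has at most |V|^N strings of
length N, and N = O(n). -/
lemma tendsto_logb_one_add_log {k : ℕ → V → ℕ} {P : V → ℝ}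
    (hk : ∀ a, Tendsto (fun n : ℕ => (k n a : ℝ) / n) atTop (𝓝 (P a))) :
    Tendsto (fun n : ℕ => Real.logb 2 (1 + Real.log (classCard (k n))) / n) atTop (𝓝 0) := by
  have h := (tendsto_log_linear_div (tendsto_sum_div hk)
    (Real.log_natCast_nonneg (Fintype.card V))).div_const (Real.log 2)
  rw [zero_div] at h
  have h0 : ∀ n, 0 ≤ Real.log (classCard (k n)) := fun n => Real.log_natCast_nonneg _
  refine squeeze_zero (fun n => div_nonneg (Real.logb_nonneg one_lt_two (by linarith [h0 n]))
    (by positivity)) (fun n => ?_) h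
  rw [Real.logb, div_right_comm]
  gcongr
  have h1 : (classCard (k n) : ℝ) ≤ (Fintype.card V : ℝ) ^ (∑ a, k n a) := by
    exact_mod_cast classCard_le (k n)
  have h2 := Real.log_le_log (by exact_mod_cast classCard_pos (k n)) h1
  rw [Real.log_pow] at h2
  linarith

end

/-! ### Existence of the probabilistic refinement -/

section

variable {V : Type u}

lemma sumElim_mem_countClass {ι κ : Type} [Finite ι] [Finite κ] {k l : V → ℕ} {x : ι → V}
    {y : κ → V} (hx : x ∈ countClass ι k) (hy : y ∈ countClass κ l) :
    Sum.elim x y ∈ countClass (ι ⊕ κ) (k + l) := fun a => by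
  rw [Pi.add_apply, ← hx a, ← hy a, ← Nat.card_sum]
  exact Nat.card_congr Equiv.subtypeSum

/-- Counts whose frequencies converge to `P` from below. -/
def floorCount (P : V → ℝ) (n : ℕ) (a : V) : ℕ := ⌊P a * n⌋₊

lemma tendsto_floorCount {P : V → ℝ} (hP : ∀ a, 0 ≤ P a) (a : V) :
    Tendsto (fun n : ℕ => (floorCount P n a : ℝ) / n) atTop (𝓝 (P a)) :=
  (tendsto_nat_floor_mul_div_atTop (hP a)).comp tendsto_natCast_atTop_atTop

variable [Fintype V] (f : SpectralPoint.{u}) (G : SimpleGraph V)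

lemma card_sum_fin (k l : V → ℕ) :
    Fintype.card (Fin (∑ a, k a) ⊕ Fin (∑ a, l a)) = ∑ a, (k + l) a := by
  simp [Finset.sum_add_distrib]

/-- Concatenation maps the product of two classes into the class of the summed counts. -/
lemma logVal_add_le (k l : V → ℕ) : logVal f G k + logVal f G l ≤ logVal f G (k + l) := by
  have hk := f.one_le_val (classGraph G (Fin (∑ a, k a)) k)
  have hl := f.one_le_val (classGraph G (Fin (∑ a, l a)) l)
  rw [← logVal_eq f G (card_sum_fin k l), logVal, logVal,
    ← Real.logb_mul (by positivity) (by positivity), ← f.strong]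
  refine Real.logb_le_logb_of_le one_lt_two ?_ ?_
  · rw [f.strong]; positivity
  · refine f.val_le_of_conf (fun x => ⟨_, sumElim_mem_countClass x.1.2 x.2.2⟩) fun x y h => ?_
    rw [conf_classGraph] at h
    rw [conf_strongProd, conf_classGraph, conf_classGraph]
    exact ⟨fun i => h (Sum.inl i), fun i => h (Sum.inr i)⟩

lemma logVal_mono {k l : V → ℕ} (h : k ≤ l) : logVal f G k ≤ logVal f G l := by
  have := logVal_add_le f G k (l - k)
  rw [add_tsub_cancel_of_le h] at this
  linarith [logVal_nonneg f G (l - k)]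

/-- Appending a fixed string with counts l - k embeds the smaller class in the larger one, whose
coordinate permutations act transitively. Translates of the image then cover it. -/
lemma logVal_le_of_le {k l : V → ℕ} (h : k ≤ l) :
    logVal f G l ≤ logVal f G k +
      (Real.logb 2 (classCard l) - Real.logb 2 (classCard k)) +
      Real.logb 2 (1 + Real.log (classCard l)) := by
  classical
  obtain ⟨r, rfl⟩ := exists_add_of_le h
  obtain ⟨y, hy⟩ := countClass_nonempty (ι := Fin (∑ a, r a)) (k := r) (by simp)
  have := Fintype.ofFinite (countClass (Fin (∑ a, k a) ⊕ Fin (∑ a, r a)) (k + r))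
  rw [← logVal_eq f G (card_sum_fin k r), ← classCard_eq (card_sum_fin k r)]
  refine f.logb_val_le_of_cover _ (classGraph G (Fin (∑ a, k a)) k)
    (fun x => ⟨_, sumElim_mem_countClass x.2 hy⟩) ?_ ?_
    permAct permAct_injective conf_permAct _ ?_ card_permAct
  · intro x x' hxx
    ext i
    exact congrFun (congrArg Subtype.val hxx) (Sum.inl i)
  · intro x x' hxx
    rw [conf_classGraph] at hxx ⊢
    rintro (i | i)
    · exact hxx i
    · exact Or.inl rfl
  · exact Finset.prod_pos fun a _ => Nat.factorial_pos _

/-- The probabilistic refinement in terms of letter counts of asymptotic frequency `P`. -/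
def IsCountLimit (P : V → ℝ) (L : ℝ) : Prop :=
  ∀ k : ℕ → V → ℕ, (∀ a, Tendsto (fun n : ℕ => (k n a : ℝ) / n) atTop (𝓝 (P a))) →
    Tendsto (fun n : ℕ => logVal f G (k n) / n) atTop (𝓝 L)

lemma tendsto_logVal_sub {P : V → ℝ} {k l : ℕ → V → ℕ} (hkl : ∀ n, k n ≤ l n)
    (hk : ∀ a, Tendsto (fun n : ℕ => (k n a : ℝ) / n) atTop (𝓝 (P a)))
    (hl : ∀ a, Tendsto (fun n : ℕ => (l n a : ℝ) / n) atTop (𝓝 (P a))) :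
    Tendsto (fun n : ℕ => logVal f G (l n) / n - logVal f G (k n) / n) atTop (𝓝 0) := by
  have h := ((tendsto_logb_classCard hl).sub (tendsto_logb_classCard hk)).add
    (tendsto_logb_one_add_log hl)
  rw [sub_self, zero_add] at h
  refine squeeze_zero (fun n => ?_) (fun n => ?_) h
  · rw [← sub_div]
    exact div_nonneg (sub_nonneg.2 (logVal_mono f G (hkl n))) n.cast_nonneg
  · rw [← sub_div, ← sub_div, ← add_div]
    refine div_le_div_of_nonneg_right ?_ n.cast_nonneg
    linarith [logVal_le_of_le f G (hkl n)]

/-- Floor counts are superadditive in n, so Fekete's lemma gives a limit along them. Other counts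
with the same frequencies are compared with them by `tendsto_logVal_sub`. -/
lemma exists_isCountLimit {P : V → ℝ} (hP : ∀ a, 0 ≤ P a) : ∃ L, IsCountLimit f G P L := by
  have hfl := tendsto_floorCount hP
  have hsub : Subadditive (fun n => -logVal f G (floorCount P n)) := fun m n => by
    have h1 : floorCount P m + floorCount P n ≤ floorCount P (m + n) := fun a => by
      simp only [floorCount, Pi.add_apply, Nat.cast_add, mul_add]
      exact Nat.le_floor (by
        push_cast
        exact add_le_add (Nat.floor_le (mul_nonneg (hP a) m.cast_nonneg))
          (Nat.floor_le (mul_nonneg (hP a) n.cast_nonneg)))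
    linarith [logVal_mono f G h1, logVal_add_le f G (floorCount P m) (floorCount P n)]
  have hbdd : BddBelow (Set.range fun n : ℕ => -logVal f G (floorCount P n) / n) := by
    obtain ⟨B, hB⟩ := (tendsto_logb_classCard hfl).bddAbove_range
    refine ⟨-B, ?_⟩
    rintro _ ⟨n, rfl⟩
    have h1 := hB ⟨n, rfl⟩
    have h2 := div_le_div_of_nonneg_right (logVal_le f G (floorCount P n)) n.cast_nonneg
    simp only [neg_div] at h1 h2 ⊢
    linarith
  have hlim : Tendsto (fun n : ℕ => logVal f G (floorCount P n) / n) atTop (𝓝 (-hsub.lim)) := by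
    refine (hsub.tendsto_lim hbdd).neg.congr fun n => ?_
    rw [neg_div, neg_neg]
  refine ⟨-hsub.lim, fun k hk => ?_⟩
  -- The pointwise minimum lies below both count sequences and has the same limiting frequencies.
  have hm : ∀ a, Tendsto (fun n : ℕ => ((k n ⊓ floorCount P n) a : ℝ) / n) atTop (𝓝 (P a)) := by
    intro a
    have := (hk a).min (hfl a)
    rw [min_self] at this
    refine this.congr fun n => ?_
    rw [Pi.inf_apply, Nat.cast_min, min_div_div_right n.cast_nonneg]
  have h1 := tendsto_logVal_sub f G (fun n => inf_le_left) hm hk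
  have h2 := tendsto_logVal_sub f G (fun n => inf_le_right) hm hfl
  have h3 := (hlim.sub h2).add h1
  rw [sub_zero, add_zero] at h3
  exact h3.congr fun n => by ring

variable {f G}

lemma IsCountLimit.isProbRefinement {P : V → ℝ} {L : ℝ} (h : IsCountLimit f G P L) :
    IsProbRefinement f G P L := by
  intro Q hQ hQP
  rw [tendsto_pi_nhds] at hQP
  have hex : ∀ n, ∃ k : V → ℕ, 0 < n → (∀ a, Q n a = k a / n) ∧ ∑ a, k a = n ∧
      typeClass n (Q n) = countClass (Fin n) k := fun n => by
    rcases Nat.eq_zero_or_pos n with rfl | hn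
    · exact ⟨0, fun h => absurd h (lt_irrefl 0)⟩
    · obtain ⟨x, hx⟩ := hQ n hn
      have hn' : (n : ℝ) ≠ 0 := by exact_mod_cast hn.ne'
      refine ⟨fun a => Nat.card {i // x i = a}, fun _ => ⟨fun a => ?_, ?_, ?_⟩⟩
      · rw [← hx]; rfl
      · have h : x ∈ countClass (Fin n) (fun a => Nat.card {i // x i = a}) := fun a => rfl
        simpa using (card_eq_of_mem_countClass h).symm
      · ext y
        rw [typeClass, Set.mem_ofPred_eq, ← hx, funext_iff]
        refine forall_congr' fun a => ?_
        simp only [stringType]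
        rw [div_left_inj' hn', Nat.cast_inj]
        rfl
  choose k hk using hex
  refine (h k fun a => (hQP a).congr' ?_).congr' ?_
  · filter_upwards [eventually_gt_atTop 0] with n hn
    exact (hk n hn).1 a
  · filter_upwards [eventually_gt_atTop 0] with n hn
    obtain ⟨-, h2, h3⟩ := hk n hn
    have hcongr : ∀ S T : Set (Fin n → V), S = T →
        f.val ((strongPow G n).induce S) = f.val ((strongPow G n).induce T) := by
      rintro S _ rfl
      rfl
    rw [← logVal_eq f G (ι := Fin n) (by simp [h2]), hcongr _ _ h3]
    rfl

/-- Without such a sequence `IsProbRefinement` would hold vacuously for every value; its existence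
makes the value unique. -/
lemma exists_tendsto_isNType {P : V → ℝ} (hP : ∀ a, 0 ≤ P a) (h1 : ∑ a, P a = 1) :
    ∃ Q : ℕ → V → ℝ, (∀ n, 0 < n → IsNType n (Q n)) ∧ Tendsto Q atTop (𝓝 P) := by
  classical
  have hne : Nonempty V := by
    by_contra hV
    rw [not_nonempty_iff] at hV
    simp at h1
  obtain ⟨a0⟩ := hne
  have hfl := tendsto_floorCount hP
  have hle : ∀ n, ∑ a, floorCount P n a ≤ n := fun n => by
    have : ((∑ a, floorCount P n a : ℕ) : ℝ) ≤ n := by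
      rw [Nat.cast_sum]
      calc ∑ a, (floorCount P n a : ℝ) ≤ ∑ a, P a * n :=
            Finset.sum_le_sum fun a _ => Nat.floor_le (mul_nonneg (hP a) n.cast_nonneg)
        _ = n := by rw [← Finset.sum_mul, h1, one_mul]
    exact_mod_cast this
  -- The letters missing after rounding down, all given to `a0`. Since P sums to 1, d(n) = o(n).
  let d : ℕ → ℕ := fun n => n - ∑ a, floorCount P n a
  have hd : Tendsto (fun n : ℕ => (d n : ℝ) / n) atTop (𝓝 0) := by
    have h := (tendsto_sum_div hfl).const_sub 1
    rw [h1, sub_self] at h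
    refine h.congr' ?_
    filter_upwards [eventually_gt_atTop 0] with n hn
    have hn' : (n : ℝ) ≠ 0 := by exact_mod_cast hn.ne'
    rw [Nat.cast_sub (hle n), sub_div, div_self hn']
  have hx : ∀ n, ∃ x : Fin n → V, x ∈ countClass (Fin n) (floorCount P n + Pi.single a0 (d n)) :=
    fun n => countClass_nonempty (by
      have := hle n
      simp only [Fintype.card_fin, Pi.add_apply, Finset.sum_add_distrib, Finset.sum_pi_single',
        Finset.mem_univ, if_true, d]
      omega)
  choose x hx using hx
  refine ⟨fun n => stringType (x n), fun n _ => ⟨x n, rfl⟩, tendsto_pi_nhds.2 fun a => ?_⟩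
  have hc : ∀ n, stringType (x n) a = floorCount P n a / n + 
      ((Pi.single a0 (d n) : V → ℕ) a) / n := fun n => by
      have : Set.ncard {i | x n i = a} =
        floorCount P n a + (Pi.single a0 (d n) : V → ℕ) a := hx n a
      rw [stringType, ← add_div, ← Nat.cast_add]
      exact congrArg (fun m : ℕ => (m : ℝ) / n) this
  simp only [hc]
  by_cases ha : a = a0
  · subst ha
    simpa using (hfl a).add hd
  · simpa [Pi.single_eq_of_ne ha] using hfl a

lemma isCountLimit_probRefinement {P : V → ℝ} (hP : ∀ a, 0 ≤ P a) (h1 : ∑ a, P a = 1) :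
    IsCountLimit f G P (probRefinement f G P) := by
  obtain ⟨L, hL⟩ := exists_isCountLimit f G hP
  have h := Classical.epsilon_spec (p := IsProbRefinement f G P) ⟨L, hL.isProbRefinement⟩
  obtain ⟨Q, hQ, hQP⟩ := exists_tendsto_isNType hP h1
  have := tendsto_nhds_unique (h Q hQ hQP) (hL.isProbRefinement Q hQ hQP)
  rw [probRefinement, this]
  exact hL

end

/-! ### Joint types and their marginals -/

section

/-- The pushforward of a function on a finite set along `π`, by summation over fibres. -/
def pushforward {W V M : Type*} [Fintype W] [AddCommMonoid M] (π : W → V) (k : W → M) (v : V) : M :=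
  open Classical in ∑ w with π w = v, k w

lemma sum_pushforward {W V M : Type*} [Fintype W] [Fintype V] [AddCommMonoid M] (π : W → V)
    (k : W → M) : ∑ v, pushforward π k v = ∑ w, k w := by
  classical
  simp only [pushforward]
  convert Finset.sum_fiberwise Finset.univ π k

lemma tendsto_pushforward {W V : Type*} [Fintype W] (π : W → V) {k : ℕ → W → ℕ} {P : W → ℝ}
    (hk : ∀ a, Tendsto (fun n : ℕ => (k n a : ℝ) / n) atTop (𝓝 (P a))) (v : V) :
    Tendsto (fun n : ℕ => ((pushforward π (k n) v : ℕ) : ℝ) / n) atTop (𝓝 (pushforward π P v)) := by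
  classical
  simp only [pushforward, Nat.cast_sum, Finset.sum_div]
  exact tendsto_finsetSum _ fun a _ => hk a

lemma comp_mem_countClass_pushforward {W V : Type u} [Fintype W] (π : W → V) {ι : Type} [Finite ι]
    {k : W → ℕ} {x : ι → W} (hx : x ∈ countClass ι k) :
    π ∘ x ∈ countClass ι (pushforward π k) := fun v => by
  classical
  have := Fintype.ofFinite ι
  simp only [pushforward]
  rw [Nat.card_eq_fintype_card, Fintype.card_subtype,
    Finset.card_eq_sum_card_fiberwise (t := Finset.univ.filter fun w => π w = v) (f := x)
      (fun i hi => by simpa using hi)]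
  refine Finset.sum_congr (by congr) fun w hw => ?_
  rw [← hx w, Nat.card_eq_fintype_card, Fintype.card_subtype, Finset.filter_filter]
  congr 1
  ext i
  simp only [Finset.mem_filter, Finset.mem_univ, true_and, Function.comp_apply] at hw ⊢
  exact ⟨fun h => h.2, fun h => ⟨by rw [h, hw], h⟩⟩

variable {W V₁ V₂ : Type u} [Fintype W] [Fintype V₁] [Fintype V₂] {f : SpectralPoint.{u}}
  {K : SimpleGraph W} {G₁ : SimpleGraph V₁} {G₂ : SimpleGraph V₂} {π₁ : W → V₁} {π₂ : W → V₂}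

/-- Splitting a joint string into its two projections lands in the product of the marginal classes
and reflects confusability. -/
lemma logVal_le_add_pushforward
    (hK : ∀ x y, Conf K x y ↔ Conf G₁ (π₁ x) (π₁ y) ∧ Conf G₂ (π₂ x) (π₂ y)) (k : W → ℕ) :
    logVal f K k ≤ logVal f G₁ (pushforward π₁ k) + logVal f G₂ (pushforward π₂ k) := by
  have h1 : Fintype.card (Fin (∑ a, k a)) = ∑ a, pushforward π₁ k a := by
    rw [sum_pushforward, Fintype.card_fin]
  have h2 : Fintype.card (Fin (∑ a, k a)) = ∑ a, pushforward π₂ k a := by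
    rw [sum_pushforward, Fintype.card_fin]
  have := (countClass_nonempty h1).to_subtype
  have := (countClass_nonempty h2).to_subtype
  have hv1 := f.one_le_val (classGraph G₁ (Fin (∑ a, k a)) (pushforward π₁ k))
  have hv2 := f.one_le_val (classGraph G₂ (Fin (∑ a, k a)) (pushforward π₂ k))
  rw [← logVal_eq f G₁ h1, ← logVal_eq f G₂ h2, ← Real.logb_mul (by positivity) (by positivity),
    ← f.strong]
  refine Real.logb_le_logb_of_le one_lt_two (zero_lt_one.trans_le (f.one_le_val _)) ?_
  refine f.val_le_of_conf (fun x => (⟨_, comp_mem_countClass_pushforward π₁ x.2⟩,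
    ⟨_, comp_mem_countClass_pushforward π₂ x.2⟩)) fun x y h => ?_
  rw [conf_strongProd, conf_classGraph, conf_classGraph] at h
  exact conf_classGraph.2 fun i => (hK _ _).2 ⟨h.1 i, h.2 i⟩

/-- The joint class embeds in the product of the marginal classes, where independent permutations of
the two factors act transitively. Its translates cover the product. -/
lemma add_pushforward_le_logVal
    (hK : ∀ x y, Conf K x y ↔ Conf G₁ (π₁ x) (π₁ y) ∧ Conf G₂ (π₂ x) (π₂ y))
    (hinj : ∀ x y, π₁ x = π₁ y → π₂ x = π₂ y → x = y) (k : W → ℕ) :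
    logVal f G₁ (pushforward π₁ k) + logVal f G₂ (pushforward π₂ k) ≤ logVal f K k +
      (Real.logb 2 (classCard (pushforward π₁ k)) + Real.logb 2 (classCard (pushforward π₂ k)) -
        Real.logb 2 (classCard k)) +
      (Real.logb 2 (1 + Real.log (classCard (pushforward π₁ k))) +
        Real.logb 2 (1 + Real.log (classCard (pushforward π₂ k)))) := by
  classical
  set k₁ := pushforward π₁ k
  set k₂ := pushforward π₂ k
  set ι := Fin (∑ a, k a)
  have h1 : Fintype.card ι = ∑ a, k₁ a := by
    rw [sum_pushforward, Fintype.card_fin]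
  have h2 : Fintype.card ι = ∑ a, k₂ a := by
    rw [sum_pushforward, Fintype.card_fin]
  have := (countClass_nonempty h1).to_subtype
  have := (countClass_nonempty h2).to_subtype
  have hv1 := f.one_le_val (classGraph G₁ ι k₁)
  have hv2 := f.one_le_val (classGraph G₂ ι k₂)
  have := Fintype.ofFinite (countClass ι k₁)
  have := Fintype.ofFinite (countClass ι k₂)
  have key := f.logb_val_le_of_cover (strongProd (classGraph G₁ ι k₁) (classGraph G₂ ι k₂))
    (classGraph K ι k) (fun x => (⟨_, comp_mem_countClass_pushforward π₁ x.2⟩,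
      ⟨_, comp_mem_countClass_pushforward π₂ x.2⟩)) ?_ ?_
    (Γ := Equiv.Perm ι × Equiv.Perm ι) (fun g x => (permAct g.1 x.1, permAct g.2 x.2)) ?_ ?_
    ((∏ a, (k₁ a).factorial) * ∏ a, (k₂ a).factorial) ?_ ?_
  · have hc1 : (1 : ℝ) ≤ classCard k₁ := by exact_mod_cast classCard_pos k₁
    have hc2 : (1 : ℝ) ≤ classCard k₂ := by exact_mod_cast classCard_pos k₂
    have hl1 := Real.log_nonneg hc1
    have hl2 := Real.log_nonneg hc2
    rw [f.strong, Real.logb_mul (by positivity) (by positivity), logVal_eq f G₁ h1,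
      logVal_eq f G₂ h2, Nat.card_prod, classCard_eq h1, classCard_eq h2, Nat.cast_mul,
      Real.logb_mul (by positivity) (by positivity),
      Real.log_mul (by positivity) (by positivity)] at key
    -- 1 + a + b ≤ (1 + a)(1 + b) for nonnegative a and b.
    have hlast : Real.logb 2 (1 + (Real.log (classCard k₁) + Real.log (classCard k₂))) ≤
        Real.logb 2 (1 + Real.log (classCard k₁)) + Real.logb 2 (1 + Real.log (classCard k₂)) := by
      rw [← Real.logb_mul (by positivity) (by positivity)]
      exact Real.logb_le_logb_of_le one_lt_two (by positivity) (by nlinarith)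
    exact key.trans (add_le_add le_rfl hlast)
  · intro x y hxy
    rw [Prod.mk.injEq, Subtype.mk.injEq, Subtype.mk.injEq] at hxy
    exact Subtype.ext (funext fun i => hinj _ _ (congrFun hxy.1 i) (congrFun hxy.2 i))
  · intro x y hxy
    rw [conf_classGraph] at hxy
    rw [conf_strongProd, conf_classGraph, conf_classGraph]
    exact ⟨fun i => ((hK _ _).1 (hxy i)).1, fun i => ((hK _ _).1 (hxy i)).2⟩
  · intro g x y hxy
    rw [Prod.mk.injEq] at hxy
    exact Prod.ext (permAct_injective _ hxy.1) (permAct_injective _ hxy.2)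
  · intro g x y hxy
    rw [conf_strongProd] at hxy ⊢
    exact ⟨conf_permAct _ _ _ hxy.1, conf_permAct _ _ _ hxy.2⟩
  · exact Nat.mul_pos (Finset.prod_pos fun a _ => Nat.factorial_pos _)
      (Finset.prod_pos fun a _ => Nat.factorial_pos _)
  · intro x y
    rw [← card_permAct x.1 y.1, ← card_permAct x.2 y.2, ← Nat.card_prod]
    refine Nat.card_congr ((Equiv.subtypeEquivRight fun g => ?_).trans Equiv.subtypeProdEquivProd)
    rw [Prod.ext_iff]

lemma IsCountLimit.le_add {P : W → ℝ} {L L₁ L₂ : ℝ} (hP : ∀ a, 0 ≤ P a)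
    (hL : IsCountLimit f K P L) (hL₁ : IsCountLimit f G₁ (pushforward π₁ P) L₁)
    (hL₂ : IsCountLimit f G₂ (pushforward π₂ P) L₂)
    (hK : ∀ x y, Conf K x y ↔ Conf G₁ (π₁ x) (π₁ y) ∧ Conf G₂ (π₂ x) (π₂ y)) :
    L ≤ L₁ + L₂ := by
  have hk := tendsto_floorCount hP
  refine le_of_tendsto_of_tendsto' (hL _ hk) ((hL₁ _ (tendsto_pushforward π₁ hk)).add
    (hL₂ _ (tendsto_pushforward π₂ hk))) fun n => ?_
  rw [← add_div]
  exact div_le_div_of_nonneg_right (logVal_le_add_pushforward hK _) n.cast_nonneg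

/-- For a probability distribution P the `classRate` term is the mutual information of the two
projections. -/
lemma IsCountLimit.add_le {P : W → ℝ} {L L₁ L₂ : ℝ} (hP : ∀ a, 0 ≤ P a)
    (hL : IsCountLimit f K P L) (hL₁ : IsCountLimit f G₁ (pushforward π₁ P) L₁)
    (hL₂ : IsCountLimit f G₂ (pushforward π₂ P) L₂)
    (hK : ∀ x y, Conf K x y ↔ Conf G₁ (π₁ x) (π₁ y) ∧ Conf G₂ (π₂ x) (π₂ y))
    (hinj : ∀ x y, π₁ x = π₁ y → π₂ x = π₂ y → x = y) :
    L₁ + L₂ ≤ L + (classRate (pushforward π₁ P) + classRate (pushforward π₂ P) - classRate P) := by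
  have hk := tendsto_floorCount hP
  have hk₁ := tendsto_pushforward π₁ hk
  have hk₂ := tendsto_pushforward π₂ hk
  have hr := (((hL _ hk).add (((tendsto_logb_classCard hk₁).add (tendsto_logb_classCard hk₂)).sub
    (tendsto_logb_classCard hk))).add
      ((tendsto_logb_one_add_log hk₁).add (tendsto_logb_one_add_log hk₂)))
  rw [add_zero, add_zero] at hr
  refine le_of_tendsto_of_tendsto' ((hL₁ _ hk₁).add (hL₂ _ hk₂)) hr fun n => ?_
  simp only [← add_div, ← sub_div]
  exact div_le_div_of_nonneg_right (add_pushforward_le_logVal hK hinj _) n.cast_nonneg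

lemma IsCountLimit.nonneg {P : W → ℝ} {L : ℝ} (hP : ∀ a, 0 ≤ P a) (hL : IsCountLimit f K P L) :
    0 ≤ L :=
  ge_of_tendsto' (hL _ (tendsto_floorCount hP)) fun n =>
    div_nonneg (logVal_nonneg f K _) n.cast_nonneg

lemma IsCountLimit.le_classRate {P : W → ℝ} {L : ℝ} (hP : ∀ a, 0 ≤ P a)
    (hL : IsCountLimit f K P L) : L ≤ classRate P :=
  le_of_tendsto_of_tendsto' (hL _ (tendsto_floorCount hP))
    (tendsto_logb_classCard (tendsto_floorCount hP)) fun n =>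
      div_le_div_of_nonneg_right (logVal_le f K _) n.cast_nonneg

end

/-! ### Blocks of a stationary source -/

section

lemma conf_strongPow {V : Type u} {G : SimpleGraph V} {n : ℕ} {x y : Fin n → V} :
    Conf (strongPow G n) x y ↔ ∀ i, Conf G (x i) (y i) := conf_powGraph

lemma conf_strongPow_add {V : Type u} {G : SimpleGraph V} {m n : ℕ} (x y : Fin (m + n) → V) :
    Conf (strongPow G (m + n)) x y ↔
      Conf (strongPow G m) (x ∘ Fin.castAdd n) (y ∘ Fin.castAdd n) ∧
      Conf (strongPow G n) (x ∘ Fin.natAdd m) (y ∘ Fin.natAdd m) := by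
  simp only [conf_strongPow]
  exact Fin.forall_fin_add _

variable {V : Type u} [MeasurableSpace V] (μ : Measure (ℕ → V))

/-- The block of `n` letters of an infinite word starting at position `m`. -/
def block (m n : ℕ) (ω : ℕ → V) : Fin n → V := fun i => ω (m + i)

lemma blockMarginal_eq (m n : ℕ) (x : Fin n → V) :
    blockMarginal μ m n x = μ.real (block m n ⁻¹' {x}) := by
  simp only [blockMarginal]
  congr 1
  ext ω
  simp [block, funext_iff]

lemma blockMarginal_nonneg (m n : ℕ) (x : Fin n → V) : 0 ≤ blockMarginal μ m n x :=
  measureReal_nonneg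

variable [Fintype V] [DiscreteMeasurableSpace V]

lemma measurableSet_block (m n : ℕ) (s : Set (Fin n → V)) :
    MeasurableSet (block m n ⁻¹' s : Set (ℕ → V)) := by
  have h : Measurable (block m n : (ℕ → V) → Fin n → V) :=
    measurable_pi_lambda _ fun i => measurable_pi_apply _
  exact h (Set.toFinite s).measurableSet

variable [IsProbabilityMeasure μ]

lemma sum_blockMarginal_filter (m n : ℕ) (s : Finset (Fin n → V)) :
    ∑ x ∈ s, blockMarginal μ m n x = μ.real (block m n ⁻¹' s) := by
  simp only [blockMarginal_eq]
  rw [← measureReal_biUnion_finset]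
  · congr 1
    ext ω
    simp
  · intro x _ y _ hxy
    exact Disjoint.preimage _ (by simpa using hxy)
  · exact fun x _ => measurableSet_block m n _

lemma sum_blockMarginal (m n : ℕ) : ∑ x, blockMarginal μ m n x = 1 := by
  rw [sum_blockMarginal_filter]
  simp

lemma pushforward_castAdd (m n : ℕ) :
    pushforward (fun x : Fin (m + n) → V => x ∘ Fin.castAdd n) (blockMarginal μ 0 (m + n)) =
      blockMarginal μ 0 m := by
  funext y
  rw [pushforward, sum_blockMarginal_filter, blockMarginal_eq]
  congr 1
  ext ω
  simp [block, funext_iff]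

lemma pushforward_natAdd (m n : ℕ) :
    pushforward (fun x : Fin (m + n) → V => x ∘ Fin.natAdd m) (blockMarginal μ 0 (m + n)) =
      blockMarginal μ m n := by
  funext y
  rw [pushforward, sum_blockMarginal_filter, blockMarginal_eq]
  congr 1
  ext ω
  simp [block, funext_iff]

variable (f : SpectralPoint.{u}) (G : SimpleGraph V)

lemma isCountLimit_blockF (n : ℕ) :
    IsCountLimit f (strongPow G n) (blockMarginal μ 0 n) (blockF f G μ n) :=
  isCountLimit_probRefinement (blockMarginal_nonneg μ 0 n) (sum_blockMarginal μ 0 n)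

lemma classRate_blockMarginal (n : ℕ) : classRate (blockMarginal μ 0 n) = blockEntropy μ n :=
  classRate_eq_entropy (sum_blockMarginal μ 0 n)

lemma blockF_nonneg (n : ℕ) : 0 ≤ blockF f G μ n :=
  (isCountLimit_blockF μ f G n).nonneg (blockMarginal_nonneg μ 0 n)

lemma blockF_le_blockEntropy (n : ℕ) : blockF f G μ n ≤ blockEntropy μ n := by
  rw [← classRate_blockMarginal]
  exact (isCountLimit_blockF μ f G n).le_classRate (blockMarginal_nonneg μ 0 n)

variable {μ}

lemma subadditive_blockF (hμ : IsStationary μ) : Subadditive (blockF f G μ) := fun m n => by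
  refine (isCountLimit_blockF μ f G (m + n)).le_add (blockMarginal_nonneg μ 0 _) ?_ ?_
    (conf_strongPow_add (m := m) (n := n))
  · rw [pushforward_castAdd]
    exact isCountLimit_blockF μ f G m
  · rw [pushforward_natAdd, hμ m n]
    exact isCountLimit_blockF μ f G n

/-- For the two sub-blocks the class rates are block entropies, so the loss in `IsCountLimit.add_le`
is H_m + H_n - H_{m+n}. Moving entropies across leaves b_{m+n} ≤ b_m + b_n. -/
lemma subadditive_blockEntropy_sub_blockF (hμ : IsStationary μ) :
    Subadditive (fun n => blockEntropy μ n - blockF f G μ n) := fun m n => by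
  have h := (isCountLimit_blockF μ f G (m + n)).add_le (L₁ := blockF f G μ m)
    (L₂ := blockF f G μ n) (blockMarginal_nonneg μ 0 _) ?_ ?_
    (conf_strongPow_add (m := m) (n := n)) ?_
  · rw [pushforward_castAdd, pushforward_natAdd, hμ m n, classRate_blockMarginal,
      classRate_blockMarginal, classRate_blockMarginal] at h
    linarith
  · rw [pushforward_castAdd]
    exact isCountLimit_blockF μ f G m
  · rw [pushforward_natAdd, hμ m n]
    exact isCountLimit_blockF μ f G n
  · intro x y h1 h2
    exact funext ((Fin.forall_fin_add _).2 ⟨congrFun h1, congrFun h2⟩)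

/-- Fekete's lemma. The index 0 is left out of the infimum because division by zero would contribute
the value 0. -/
lemma tendsto_and_isGLB_of_subadditive {u : ℕ → ℝ} (h : Subadditive u) (h0 : ∀ n, 0 ≤ u n) :
    ∃ L, Tendsto (fun n => u n / n) atTop (𝓝 L) ∧
      IsGLB ((fun n : ℕ => u n / n) '' Set.Ici 1) L := by
  have hb : BddBelow (Set.range fun n : ℕ => u n / n) :=
    ⟨0, by rintro _ ⟨n, rfl⟩; exact div_nonneg (h0 n) n.cast_nonneg⟩
  refine ⟨h.lim, h.tendsto_lim hb, ?_⟩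
  rw [Subadditive.lim]
  exact isGLB_csInf (Set.Nonempty.image _ ⟨1, Set.mem_Ici.2 le_rfl⟩)
    (hb.mono (Set.image_subset_range _ _))

end

end AmbiguousSource

end

open AmbiguousSource in
theorem mainTheorem5 {V : Type u} [Fintype V] [MeasurableSpace V] [DiscreteMeasurableSpace V]
    (f : SpectralPoint.{u}) (G : SimpleGraph V)
    (μ : Measure (ℕ → V)) [IsProbabilityMeasure μ] (hμ : IsStationary μ) :
    -- `F(G^{⊠ n}, μ_{1…n})` is well defined
    (∀ n : ℕ, IsProbRefinement f (strongPow G n) (blockMarginal μ 0 n) (blockF f G μ n)) ∧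
    -- the `F`-rate exists and is the infimum
    Tendsto (fun n : ℕ => blockF f G μ n / n) atTop (𝓝 (FRate f G μ)) ∧
    IsGLB ((fun n : ℕ => blockF f G μ n / n) '' Set.Ici 1) (FRate f G μ) ∧
    -- the formulas in terms of the entropy rate
    Tendsto (fun n : ℕ => blockEntropy μ n / n) atTop (𝓝 (entropyRate μ)) ∧
    (∀ n : ℕ, 0 ≤ blockEntropy μ n - blockF f G μ n) ∧
    Tendsto (fun n : ℕ => (blockEntropy μ n - blockF f G μ n) / n) atTop
      (𝓝 (entropyRate μ - FRate f G μ)) ∧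
    IsGLB ((fun n : ℕ => (blockEntropy μ n - blockF f G μ n) / n) '' Set.Ici 1)
      (entropyRate μ - FRate f G μ) ∧
    IsLUB ((fun n : ℕ => entropyRate μ - (blockEntropy μ n - blockF f G μ n) / n) '' Set.Ici 1)
      (FRate f G μ) := by
  have hb0 : ∀ n, 0 ≤ blockEntropy μ n - blockF f G μ n := fun n =>
    sub_nonneg.2 (blockF_le_blockEntropy μ f G n)
  obtain ⟨LF, hF, hFinf⟩ := tendsto_and_isGLB_of_subadditive (subadditive_blockF f G hμ)
    (blockF_nonneg μ f G)
  obtain ⟨Lb, hb, hbinf⟩ := tendsto_and_isGLB_of_subadditive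
    (subadditive_blockEntropy_sub_blockF f G hμ) hb0
  -- Subadditivity of entropy is not needed separately: H_n = b_n + F_n, and both summands have
  -- rates.
  have hH : Tendsto (fun n : ℕ => blockEntropy μ n / n) atTop (𝓝 (Lb + LF)) :=
    (hb.add hF).congr fun n => by ring
  have hFR : FRate f G μ = LF := hF.limUnder_eq
  have hHR : entropyRate μ = Lb + LF := hH.limUnder_eq
  rw [hFR, hHR, add_sub_cancel_right]
  refine ⟨fun n => (isCountLimit_blockF μ f G n).isProbRefinement, hF, hFinf, hH, hb0, hb, hbinf,
    ?_, ?_⟩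
  · rintro _ ⟨n, hn, rfl⟩
    have := hbinf.1 ⟨n, hn, rfl⟩
    dsimp only at this ⊢
    linarith
  · intro z hz
    have : Lb + LF - z ≤ Lb := hbinf.2 (by
      rintro _ ⟨n, hn, rfl⟩
      have := hz ⟨n, hn, rfl⟩
      dsimp only at this ⊢
      linarith)
    linarith
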